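/- Let $F$ be a locally compact Hausdorff space. Let $G=\mathrm{Homeo}(F)$ be its group of self-homeomorphisms under composition, with Arens' $g$-topology: a subbase consists of the sets $\{g\in G : g(K)\subseteq W\}$ with $K\subseteq F$ closed and $W\subseteq F$ open such that $K$ or $F\setminus W$ is compact. For a topological space $A$, the indiscrete cone $c(A)$ is the set $A\sqcup\{0\}$ whose open sets are the open sets of $A$ and the whole set. For a cardinal $\kappa$ and a set $I$ with $\mathrm{card}(I)=\kappa$, let $E^\kappa G := c(G)^I\setminus\{0\}^I$ with the subspace topology of the product topology and the right $G$-action by right multiplication in each coordinate (fixing $0$), and let $B^\kappa G:=E^\kappa G/G$ be the orbit space with the quotient topology. Let $E^\kappa G\times_G F := (E^\kappa G\times F)/\big((eg,y)\sim(e,g(y))\big)$ with the quotient topology, and with the projection $E^\kappa G\times_G F\to B^\kappa G$, $[e,y]\mapsto eG$. Let $B$ be a locally connected topological space and let $\kappa$ be a cardinal. Let $p:E\to B$ be a fiber bundle with fiber $F$ (and no prescribed structure group) that is covered by $\kappa$ many local trivializations, that is, there are open sets $U_j\subseteq B$ ($j\in J$, $\mathrm{card}(J)=\kappa$) that cover $B$,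 and homeomorphisms $p^{-1}(U_j)\cong U_j\times F$ over $U_j$. Then there is a continuous map $f:B\to B^\kappa G$ such that $p:E\to B$ is isomorphic to the pullback $$f^*(E^\kappa G\times_G F)=\{(b,z)\in B\times(E^\kappa G\times_G F) : f(b)=[z]\},$$ where $[z]\in B^\kappa G$ is the image of $z$ under the projection; that is, there is a homeomorphism $E\cong f^*(E^\kappa G\times_G F)$ over $B$. -/

import Mathlib

open Set Topology MulOpposite

universe u v w x

/-- The group `Homeo(F)` of self-homeomorphisms of a space `F` (multiplication is composition),
to be endowed with the `g`-topology. -/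
def ArensHomeo (F : Type u) [TopologicalSpace F] : Type u := F ≃ₜ F

namespace ArensHomeo

variable {F : Type u} [TopologicalSpace F]

instance : Group (ArensHomeo F) := inferInstanceAs (Group (F ≃ₜ F))

/-- The underlying homeomorphism. -/
def toHomeomorph (g : ArensHomeo F) : F ≃ₜ F := g

/-- The left action of `Homeo(F)` on `F` by evaluation. -/
instance : MulAction (ArensHomeo F) F where
  smul g y := g.toHomeomorph y
  one_smul _ := rfl
  mul_smul _ _ _ := rfl

/-- Arens' `g`-topology on `Homeo(F)`: a subbase consists of the sets `{g | g(K) ⊆ W}` with `K`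
closed and `W` open in `F`, where `K` or the complement of `W` is compact. -/
instance : TopologicalSpace (ArensHomeo F) :=
  TopologicalSpace.generateFrom
    {S | ∃ K W : Set F, IsClosed K ∧ IsOpen W ∧ (IsCompact K ∨ IsCompact Wᶜ) ∧
      S = {g : ArensHomeo F | MapsTo g.toHomeomorph K W}}

end ArensHomeo

/-- The underlying set `A ⊔ {0}` of the indiscrete cone `c(A)`; the extra point `0` is `apex`. -/
inductive IndiscreteCone (A : Type u) : Type u
  | apex : IndiscreteCone A
  | base (a : A) : IndiscreteCone A

namespace IndiscreteCone

variable {A : Type u}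

/-- The open sets of `c(A)` are the open sets of `A` together with the whole cone. -/
instance [TopologicalSpace A] : TopologicalSpace (IndiscreteCone A) where
  IsOpen U := U = univ ∨ ∃ V : Set A, IsOpen V ∧ U = base '' V
  isOpen_univ := Or.inl rfl
  isOpen_inter := by
    rintro _ _ (rfl | ⟨V, hV, rfl⟩) (rfl | ⟨V', hV', rfl⟩)
    · exact Or.inl (by simp)
    · exact Or.inr ⟨V', hV', by simp⟩
    · exact Or.inr ⟨V, hV, by simp⟩
    · refine Or.inr ⟨V ∩ V', hV.inter hV', ?_⟩
      rw [image_inter]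
      intro a b h
      cases h
      rfl
  isOpen_sUnion := by
    intro 𝒰 h𝒰
    by_cases hu : univ ∈ 𝒰
    · exact Or.inl (eq_univ_of_univ_subset (subset_sUnion_of_mem hu))
    · refine Or.inr ⟨⋃₀ {V | IsOpen V ∧ base '' V ∈ 𝒰}, isOpen_sUnion fun V hV => hV.1, ?_⟩
      ext z
      constructor
      · rintro ⟨U, hU, hz⟩
        rcases h𝒰 U hU with rfl | ⟨V, hV, rfl⟩
        · exact absurd hU hu
        · obtain ⟨a, ha, rfl⟩ := hz
          exact ⟨a, ⟨V, ⟨hV, hU⟩, ha⟩, rfl⟩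
      · rintro ⟨a, ⟨V, ⟨_, hU⟩, ha⟩, rfl⟩
        exact ⟨_, hU, ⟨a, ha, rfl⟩⟩

/-- An action on `A` extends to `c(A)` by fixing the apex. -/
instance {M : Type v} [Monoid M] [MulAction M A] : MulAction M (IndiscreteCone A) where
  smul m z := match z with
    | apex => apex
    | base a => base (m • a)
  one_smul z := by
    cases z with
    | apex => rfl
    | base a => exact congrArg base (one_smul M a)
  mul_smul m n z := by
    cases z with
    | apex => rfl
    | base a => exact congrArg base (mul_smul m n a)

end IndiscreteCone

/-- Segal's space `E^κ G = c(G)^I - {0}^I`, where `κ` is the cardinality of the index set `I`,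
with the subspace topology of the product topology. -/
def SegalE (G : Type u) (I : Type w) : Type (max u w) :=
  {e : I → IndiscreteCone G // e ≠ fun _ => IndiscreteCone.apex}

namespace SegalE

variable {G : Type u} {I : Type w}

instance [TopologicalSpace G] : TopologicalSpace (SegalE G I) :=
  inferInstanceAs
    (TopologicalSpace {e : I → IndiscreteCone G // e ≠ fun _ => IndiscreteCone.apex})

/-- The right action of `G` on `E^κ G`, by right multiplication in each coordinate: `op g • e`
is `e g`. Right `G`-actions are written as actions of the opposite group `Gᵐᵒᵖ`. -/
instance [Group G] : MulAction Gᵐᵒᵖ (SegalE G I) where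
  smul g e := ⟨g • e.1, fun h => e.2 (by
    have h' := congrArg (fun e' => g⁻¹ • e') h
    simp only [inv_smul_smul] at h'
    exact h')⟩
  one_smul e := Subtype.ext (one_smul Gᵐᵒᵖ e.1)
  mul_smul g h e := Subtype.ext (mul_smul g h e.1)

end SegalE

/-- The classifying space `B^κ G = E^κ G / G`; it carries the quotient topology. -/
abbrev SegalB (G : Type u) [Group G] (I : Type w) : Type (max u w) :=
  MulAction.orbitRel.Quotient Gᵐᵒᵖ (SegalE G I)

/-- The balanced product `X ×_G Y = (X × Y) / ((x g, y) ∼ (x, g y))` of a right `G`-space `X` and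
a left `G`-space `Y`; as a `Quot` of a product it carries the quotient topology. -/
abbrev BalancedProduct (G : Type u) [Group G] (X : Type v) [MulAction Gᵐᵒᵖ X]
    (Y : Type w) [MulAction G Y] : Type (max v w) :=
  Quot fun p q : X × Y => ∃ (x : X) (g : G) (y : Y), p = (op g • x, y) ∧ q = (x, g • y)

/-- The projection `X ×_G Y → X / G`, `[x, y] ↦ x G`. -/
def BalancedProduct.proj (G : Type u) [Group G] (X : Type v) [MulAction Gᵐᵒᵖ X]
    (Y : Type w) [MulAction G Y] :
    BalancedProduct G X Y → MulAction.orbitRel.Quotient Gᵐᵒᵖ X :=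
  Quot.lift (fun p => (Quotient.mk _ p.1 : MulAction.orbitRel.Quotient Gᵐᵒᵖ X)) (by
    rintro _ _ ⟨x, g, y, rfl, rfl⟩
    exact MulAction.orbitRel.Quotient.quotient_smul_eq)

namespace ArensHomeo

variable {F : Type u} [TopologicalSpace F]

theorem ext {g h : ArensHomeo F} (H : ∀ y : F, g • y = h • y) : g = h :=
  Homeomorph.ext H

/-- A family of homeomorphisms which is jointly continuous together with the family of its
inverses is continuous for the `g`-topology. -/
theorem continuous_of_continuous_smul {X : Type*} [TopologicalSpace X] {h : X → ArensHomeo F}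
    (h₁ : Continuous fun z : X × F => h z.1 • z.2)
    (h₂ : Continuous fun z : X × F => (h z.1)⁻¹ • z.2) : Continuous h := by
  have open_mapsTo {k : X → ArensHomeo F} (hk : Continuous fun z : X × F => k z.1 • z.2)
      {K W : Set F} (hK : IsCompact K) (hW : IsOpen W) :
      IsOpen {x | MapsTo (fun y : F => k x • y) K W} :=
    (ContinuousMap.isOpen_setOfPred_mapsTo hK hW).preimage (ContinuousMap.curry ⟨_, hk⟩).continuous
  refine continuous_generateFrom_iff.2 ?_
  rintro _ ⟨K, W, hK, hW, hc | hc, rfl⟩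
  · exact open_mapsTo h₁ hc hW
  · convert open_mapsTo (k := fun x => (h x)⁻¹) h₂ hc hK.isOpen_compl using 1
    ext x
    constructor
    · intro H y hy hy'
      apply hy
      have : h x • (h x)⁻¹ • y ∈ W := H hy'
      rwa [smul_inv_smul] at this
    · intro H y hy
      by_contra hy'
      have : (h x)⁻¹ • h x • y ∈ Kᶜ := H hy'
      rw [inv_smul_smul] at this
      exact this hy

/-- The `g`-topology is finer than the compact-open topology. -/
theorem continuous_toContinuousMap [T2Space F] :
    Continuous fun g : ArensHomeo F => (g.toHomeomorph : C(F, F)) :=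
  ContinuousMap.continuous_compactOpen.2 fun K hK W hW =>
    TopologicalSpace.isOpen_generateFrom_of_mem ⟨K, W, hK.isClosed, hW, Or.inl hK, rfl⟩

instance [T2Space F] [LocallyCompactSpace F] : ContinuousSMul (ArensHomeo F) F where
  continuous_smul := by
    have h : Continuous fun z : ArensHomeo F × F => (z.1.toHomeomorph : C(F, F)) z.2 :=
      ContinuousEval.continuous_eval.comp
        ((continuous_toContinuousMap.comp continuous_fst).prodMk continuous_snd)
    exact h

end ArensHomeo

namespace IndiscreteCone

variable {A : Type u}

theorem base_injective : Function.Injective (base : A → IndiscreteCone A) :=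
  fun _ _ h => base.inj h

/-- The map `c(M) × Y → c(Y)` induced by an action `M × Y → Y`. -/
def act {M : Type u} {Y : Type v} [SMul M Y] : IndiscreteCone M → Y → IndiscreteCone Y
  | apex, _ => apex
  | base g, y => base (g • y)

open Classical in
/-- The extension by the apex of a map defined on a subset. -/
noncomputable def extend {X : Type*} {S : Set X} (t : S → A) (x : X) : IndiscreteCone A :=
  if h : x ∈ S then base (t ⟨x, h⟩) else apex

theorem extend_of_mem {X : Type*} {S : Set X} (t : S → A) {x : X} (h : x ∈ S) :
    extend t x = base (t ⟨x, h⟩) :=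
  dif_pos h

variable [TopologicalSpace A]

theorem isOpen_image_base {V : Set A} (hV : IsOpen V) : IsOpen (base '' V) :=
  Or.inr ⟨V, hV, rfl⟩

theorem continuous_of_isOpen_preimage {X : Type*} [TopologicalSpace X] {f : X → IndiscreteCone A}
    (h : ∀ V : Set A, IsOpen V → IsOpen (f ⁻¹' (base '' V))) : Continuous f := by
  refine ⟨?_⟩
  rintro _ (rfl | ⟨V, hV, rfl⟩)
  · exact isOpen_univ
  · exact h V hV

theorem isOpenEmbedding_base : IsOpenEmbedding (base : A → IndiscreteCone A) :=
  .of_continuous_injective_isOpenMap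
    (continuous_of_isOpen_preimage fun V hV => by rwa [preimage_image_eq _ base_injective])
    base_injective fun _ hV => isOpen_image_base hV

theorem continuous_extend {X : Type*} [TopologicalSpace X] {S : Set X} (hS : IsOpen S)
    {t : S → A} (ht : Continuous t) : Continuous (extend t) := by
  refine continuous_of_isOpen_preimage fun V hV => ?_
  convert hS.isOpenMap_subtype_val _ (hV.preimage ht) using 1
  ext x
  by_cases h : x ∈ S <;> simp [extend, h]

theorem continuous_act {M : Type u} {Y : Type v} [TopologicalSpace M] [TopologicalSpace Y]
    [SMul M Y] [ContinuousSMul M Y] :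
    Continuous fun z : IndiscreteCone M × Y => act z.1 z.2 := by
  refine continuous_of_isOpen_preimage fun V hV => ?_
  convert (isOpenEmbedding_base.prodMap IsOpenEmbedding.id).isOpenMap _
    (hV.preimage (continuous_smul (M := M) (X := Y))) using 1
  ext ⟨z, y⟩
  cases z <;> simp [act]

end IndiscreteCone

namespace BalancedProduct

variable {G : Type u} [Group G] {I : Type w} {Y : Type v} [MulAction G Y]

theorem mk_smul {X : Type*} [MulAction Gᵐᵒᵖ X] (x : X) (g : G) (y : Y) :
    (Quot.mk _ (op g • x, y) : BalancedProduct G X Y) = Quot.mk _ (x, g • y) :=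
  Quot.sound ⟨x, g, y, rfl, rfl⟩

/-- The map `E^κ G ×_G Y → c(Y)`, `[e, y] ↦ e_i y`. -/
def evalAt (i : I) : BalancedProduct G (SegalE G I) Y → IndiscreteCone Y :=
  Quot.lift (fun z => (z.1.1 i).act z.2) (by
    rintro _ _ ⟨e, g, y, rfl, rfl⟩
    change (op g • e.1 i).act y = (e.1 i).act (g • y)
    cases e.1 i with
    | apex => rfl
    | base a => exact congrArg IndiscreteCone.base (mul_smul a g y))

theorem continuous_evalAt [TopologicalSpace G] [TopologicalSpace Y] [ContinuousSMul G Y] (i : I) :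
    Continuous (evalAt i : BalancedProduct G (SegalE G I) Y → IndiscreteCone Y) := by
  have h : Continuous fun z : SegalE G I × Y => (z.1.1 i, z.2) :=
    ((continuous_apply i).comp (continuous_subtype_val.comp continuous_fst)).prodMk continuous_snd
  exact continuous_quot_lift _ (IndiscreteCone.continuous_act.comp h)

end BalancedProduct

namespace Bundle.Trivialization

variable {F : Type u} [TopologicalSpace F] {B : Type v} [TopologicalSpace B]
  {E : Type x} [TopologicalSpace E] {p : E → B}

theorem continuousOn_coordChange_uncurry (ψ χ : Trivialization F p) :
    ContinuousOn (fun z : B × F => ψ.coordChange χ z.1 z.2)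
      ((ψ.baseSet ∩ χ.baseSet) ×ˢ univ) := by
  refine continuous_snd.comp_continuousOn (χ.continuousOn_toFun.comp
    (ψ.toOpenPartialHomeomorph.continuousOn_symm.mono ?_) ?_)
  · exact fun z hz => ψ.mem_target.2 hz.1.1
  · intro z hz
    refine χ.mem_source.2 ?_
    rw [ψ.proj_symm_apply (ψ.mem_target.2 hz.1.1)]
    exact hz.1.2

/-- The transition homeomorphism between two trivializations, as an element of `Homeo(F)`. -/
def transition (ψ χ : Trivialization F p) (b : ↥(ψ.baseSet ∩ χ.baseSet)) : ArensHomeo F :=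
  ψ.coordChangeHomeomorph χ b.2.1 b.2.2

theorem transition_smul (ψ χ : Trivialization F p) (b : ↥(ψ.baseSet ∩ χ.baseSet)) (y : F) :
    ψ.transition χ b • y = ψ.coordChange χ b y :=
  rfl

theorem continuous_transition (ψ χ : Trivialization F p) : Continuous (ψ.transition χ) := by
  have hc : Continuous fun z : ↥(ψ.baseSet ∩ χ.baseSet) × F => ((z.1 : B), z.2) := by fun_prop
  refine ArensHomeo.continuous_of_continuous_smul ?_ ?_
  · exact (ψ.continuousOn_coordChange_uncurry χ).comp_continuous hc fun z => ⟨z.1.2, trivial⟩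
  · exact (χ.continuousOn_coordChange_uncurry ψ).comp_continuous hc
      fun z => ⟨z.1.2.symm, trivial⟩

theorem continuous_proj_of_cover {I : Type*} (φ : I → Trivialization F p)
    (hφ : ∀ b, ∃ j, b ∈ (φ j).baseSet) : Continuous p :=
  continuous_iff_continuousAt.2 fun e =>
    have ⟨j, hj⟩ := hφ (p e)
    (φ j).continuousAt_proj ((φ j).mem_source.2 hj)

section Atlas

variable {I : Type w} (φ : I → Trivialization F p)

/-- The local section over `U_j` of the principal bundle of a fiber bundle, mapped to `E^κ G`:
its `i`-th coordinate is the transition from the `j`-th to the `i`-th trivialization. -/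
noncomputable def segalSection (j : I) (b : (φ j).baseSet) : SegalE (ArensHomeo F) I :=
  ⟨fun i => IndiscreteCone.extend (S := {c : (φ j).baseSet | (c : B) ∈ (φ i).baseSet})
      (fun c => (φ j).transition (φ i) ⟨c, c.1.2, c.2⟩) b, fun h => by
    have := congrFun h j
    rw [IndiscreteCone.extend_of_mem (x := b) _ b.2] at this
    cases this⟩

theorem segalSection_of_mem {j i : I} (b : (φ j).baseSet) (h : (b : B) ∈ (φ i).baseSet) :
    (segalSection φ j b).1 i = .base ((φ j).transition (φ i) ⟨b, b.2, h⟩) :=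
  dif_pos h

theorem segalSection_of_notMem {j i : I} (b : (φ j).baseSet) (h : (b : B) ∉ (φ i).baseSet) :
    (segalSection φ j b).1 i = .apex :=
  dif_neg h

theorem continuous_segalSection (j : I) : Continuous (segalSection φ j) := by
  refine Continuous.subtype_mk (continuous_pi fun i => ?_) _
  refine IndiscreteCone.continuous_extend
    ((φ i).open_baseSet.preimage continuous_subtype_val) ?_
  exact ((φ j).continuous_transition (φ i)).comp (by fun_prop)

theorem segalSection_eq_smul {j k : I} {b : B} (hj : b ∈ (φ j).baseSet)
    (hk : b ∈ (φ k).baseSet) :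
    segalSection φ k ⟨b, hk⟩ =
      op ((φ k).transition (φ j) ⟨b, hk, hj⟩) • segalSection φ j ⟨b, hj⟩ := by
  refine Subtype.ext (funext fun i => ?_)
  change _ = op ((φ k).transition (φ j) ⟨b, hk, hj⟩) • (segalSection φ j ⟨b, hj⟩).1 i
  by_cases hi : b ∈ (φ i).baseSet
  · rw [segalSection_of_mem φ ⟨b, hk⟩ hi, segalSection_of_mem φ ⟨b, hj⟩ hi]
    refine congrArg IndiscreteCone.base (ArensHomeo.ext fun y => ?_)
    exact ((φ k).coordChange_coordChange (φ j) (φ i) hk hj y).symm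
  · rw [segalSection_of_notMem φ ⟨b, hk⟩ hi, segalSection_of_notMem φ ⟨b, hj⟩ hi]
    rfl

variable (hφ : ∀ b, ∃ j, b ∈ (φ j).baseSet)

/-- The classifying map of an atlas. -/
noncomputable def segalMap (b : B) : SegalB (ArensHomeo F) I :=
  Quotient.mk _ (segalSection φ (hφ b).choose ⟨b, (hφ b).choose_spec⟩)

theorem segalMap_eq {j : I} {b : B} (hj : b ∈ (φ j).baseSet) :
    segalMap φ hφ b = Quotient.mk _ (segalSection φ j ⟨b, hj⟩) := by
  rw [segalMap, segalSection_eq_smul φ hj (hφ b).choose_spec]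
  exact MulAction.orbitRel.Quotient.quotient_smul_eq

theorem continuous_segalMap : Continuous (segalMap φ hφ) := by
  refine continuous_of_cover_nhds (s := fun j => (φ j).baseSet)
    (fun b => (hφ b).imp fun j hj => (φ j).open_baseSet.mem_nhds hj) fun j => ?_
  rw [continuousOn_iff_continuous_domRestrict]
  have h : (φ j).baseSet.domRestrict (segalMap φ hφ) =
      fun b => Quotient.mk _ (segalSection φ j b) :=
    funext fun b => segalMap_eq φ hφ b.2
  rw [h]
  exact continuous_quot_mk.comp (continuous_segalSection φ j)

/-- The bundle map over `segalMap` from the total space to the universal bundle. -/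
noncomputable def segalBundleMap (e : E) :
    BalancedProduct (ArensHomeo F) (SegalE (ArensHomeo F) I) F :=
  Quot.mk _ (segalSection φ (hφ (p e)).choose ⟨p e, (hφ (p e)).choose_spec⟩,
    (φ (hφ (p e)).choose e).2)

theorem segalBundleMap_eq {j : I} {e : E} (hj : p e ∈ (φ j).baseSet) :
    segalBundleMap φ hφ e = Quot.mk _ (segalSection φ j ⟨p e, hj⟩, (φ j e).2) := by
  rw [segalBundleMap, segalSection_eq_smul φ hj (hφ (p e)).choose_spec, BalancedProduct.mk_smul,
    transition_smul, coordChange_apply_snd _ _ (hφ (p e)).choose_spec]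

theorem continuous_segalBundleMap : Continuous (segalBundleMap φ hφ) := by
  have hp := continuous_proj_of_cover φ hφ
  refine continuous_of_cover_nhds (s := fun j => p ⁻¹' (φ j).baseSet)
    (fun e => (hφ (p e)).imp fun j hj =>
      ((φ j).open_baseSet.preimage hp).mem_nhds hj) fun j => ?_
  rw [continuousOn_iff_continuous_domRestrict]
  have h₁ : Continuous fun e : ↥(p ⁻¹' (φ j).baseSet) =>
      segalSection φ j ⟨p e, e.2⟩ :=
    (continuous_segalSection φ j).comp
      (Continuous.subtype_mk (hp.comp continuous_subtype_val) fun e => e.2)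
  have h₂ : Continuous fun e : ↥(p ⁻¹' (φ j).baseSet) => (φ j e).2 :=
    continuous_snd.comp ((φ j).continuousOn_toFun.comp_continuous continuous_subtype_val
      fun e => (φ j).mem_source.2 e.2)
  have h : (p ⁻¹' (φ j).baseSet).domRestrict (segalBundleMap φ hφ) =
      fun e : ↥(p ⁻¹' (φ j).baseSet) => Quot.mk _ (segalSection φ j ⟨p e, e.2⟩, (φ j e).2) :=
    funext fun e => segalBundleMap_eq φ hφ e.2
  rw [h]
  exact continuous_quot_mk.comp (h₁.prodMk h₂)

theorem evalAt_segalBundleMap {i : I} {e : E} (hi : p e ∈ (φ i).baseSet) :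
    BalancedProduct.evalAt i (segalBundleMap φ hφ e) = .base (φ i e).2 := by
  rw [segalBundleMap_eq φ hφ hi]
  change ((segalSection φ i ⟨p e, hi⟩).1 i).act _ = _
  rw [segalSection_of_mem φ ⟨p e, hi⟩ hi]
  exact congrArg IndiscreteCone.base ((φ i).coordChange_same_apply hi _)

/-- The comparison map from the total space to the pullback of the universal bundle. -/
noncomputable def toSegalPullback (e : E) : Function.Pullback (segalMap φ hφ)
    (BalancedProduct.proj (ArensHomeo F) (SegalE (ArensHomeo F) I) F) :=
  ⟨(p e, segalBundleMap φ hφ e), rfl⟩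

theorem toSegalPullback_bijective : Function.Bijective (toSegalPullback φ hφ) := by
  constructor
  · intro e e' h
    have hp : p e = p e' := congrArg (fun z => z.1.1) h
    have hm : segalBundleMap φ hφ e = segalBundleMap φ hφ e' := congrArg (fun z => z.1.2) h
    obtain ⟨j, hj⟩ := hφ (p e)
    have hj' : p e' ∈ (φ j).baseSet := hp ▸ hj
    have hy := congrArg (BalancedProduct.evalAt j) hm
    rw [evalAt_segalBundleMap φ hφ hj, evalAt_segalBundleMap φ hφ hj'] at hy
    refine (φ j).injOn ((φ j).mem_source.2 hj) ((φ j).mem_source.2 hj') ?_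
    change φ j e = φ j e'
    rw [← (φ j).mk_proj_snd' hj, ← (φ j).mk_proj_snd' hj', hp,
      IndiscreteCone.base_injective hy]
  · rintro ⟨⟨b, w⟩, hw⟩
    induction w using Quot.ind with | mk w =>
    obtain ⟨ε, y⟩ := w
    obtain ⟨j, hj⟩ := hφ b
    have hε : (Quotient.mk _ ε : SegalB (ArensHomeo F) I) =
        Quotient.mk _ (segalSection φ j ⟨b, hj⟩) :=
      hw.symm.trans (segalMap_eq φ hφ hj)
    obtain ⟨g, rfl⟩ := MulAction.orbitRel_apply.1 (Quotient.exact hε)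
    have ht : (b, g.unop • y) ∈ (φ j).target := (φ j).mem_target.2 hj
    have hpe := (φ j).proj_symm_apply ht
    refine ⟨(φ j).toOpenPartialHomeomorph.symm (b, g.unop • y), Subtype.ext (Prod.ext hpe ?_)⟩
    refine (segalBundleMap_eq φ hφ (j := j) (hpe.symm ▸ hj)).trans ?_
    rw [(φ j).apply_symm_apply ht]
    simp only [hpe]
    exact (BalancedProduct.mk_smul _ g.unop y).symm

theorem isInducing_toSegalPullback [T2Space F] [LocallyCompactSpace F] :
    IsInducing (toSegalPullback φ hφ) := by
  have hc : Continuous (toSegalPullback φ hφ) :=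
    Continuous.subtype_mk
      ((continuous_proj_of_cover φ hφ).prodMk (continuous_segalBundleMap φ hφ)) _
  refine isInducing_iff_nhds.2 fun e => le_antisymm hc.continuousAt.le_comap ?_
  obtain ⟨i, hi⟩ := hφ (p e)
  have hp : Filter.Tendsto p (Filter.comap (toSegalPullback φ hφ) (𝓝 (toSegalPullback φ hφ e)))
      (𝓝 (p e)) :=
    ((continuous_fst.comp continuous_subtype_val).tendsto (toSegalPullback φ hφ e)).comp
      Filter.tendsto_comap
  rw [(φ i).nhds_eq_inf_comap ((φ i).mem_source.2 hi)]
  refine le_inf hp.le_comap (Filter.Tendsto.le_comap ?_)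
  rw [IndiscreteCone.isOpenEmbedding_base.tendsto_nhds_iff]
  have h : Filter.Tendsto (fun e' => BalancedProduct.evalAt i (segalBundleMap φ hφ e'))
      (Filter.comap (toSegalPullback φ hφ) (𝓝 (toSegalPullback φ hφ e)))
      (𝓝 (BalancedProduct.evalAt i (segalBundleMap φ hφ e))) :=
    (((BalancedProduct.continuous_evalAt i).comp
      (continuous_snd.comp continuous_subtype_val)).tendsto (toSegalPullback φ hφ e)).comp
      Filter.tendsto_comap
  rw [evalAt_segalBundleMap φ hφ hi] at h
  refine h.congr' ?_
  filter_upwards [hp ((φ i).open_baseSet.mem_nhds hi)] with e' he'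
  exact evalAt_segalBundleMap φ hφ he'

end Atlas

end Bundle.Trivialization

theorem mainTheorem10
    {F : Type u} [TopologicalSpace F] [T2Space F] [LocallyCompactSpace F]
    {B : Type v} [TopologicalSpace B] [LocallyConnectedSpace B]
    {E : Type x} [TopologicalSpace E] (p : E → B)
    (κ : Cardinal.{w})
    -- the bundle `p` with fiber `F` is covered by `κ` many local trivializations
    {J : Type w} (hJ : Cardinal.mk J = κ) (φ : J → Bundle.Trivialization F p)
    (hφ : ⋃ j, (φ j).baseSet = univ)
    -- the index set used to form `E^κ G` and `B^κ G`
    {I : Type w} (hI : Cardinal.mk I = κ) :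
    ∃ f : C(B, SegalB (ArensHomeo F) I),
      ∃ Φ : E ≃ₜ Function.Pullback f
          (BalancedProduct.proj (ArensHomeo F) (SegalE (ArensHomeo F) I) F),
        ∀ e : E, (Φ e).fst = p e := by
  obtain ⟨σ⟩ := Cardinal.eq.1 (hI.trans hJ.symm)
  have hcov (b : B) : ∃ i, b ∈ (φ (σ i)).baseSet := by
    obtain ⟨j, hj⟩ := mem_iUnion.1 (hφ ▸ mem_univ b)
    exact ⟨σ.symm j, by rwa [σ.apply_symm_apply]⟩
  refine ⟨⟨_, Bundle.Trivialization.continuous_segalMap (fun i => φ (σ i)) hcov⟩,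
    (Equiv.ofBijective _ (Bundle.Trivialization.toSegalPullback_bijective
      (fun i => φ (σ i)) hcov)).toHomeomorphOfIsInducing
      (Bundle.Trivialization.isInducing_toSegalPullback (fun i => φ (σ i)) hcov), fun e => rfl⟩
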